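/- Let $|G_{1,2}\rangle=\frac{1}{\sqrt2}(|000\rangle\pm|111\rangle)$, $|G_{3,4}\rangle=\frac{1}{\sqrt2}(|001\rangle\pm|110\rangle)$, $|G_{5,6}\rangle=\frac{1}{\sqrt2}(|010\rangle\pm|101\rangle)$, $|G_{7,8}\rangle=\frac{1}{\sqrt2}(|100\rangle\pm|011\rangle)$ be the eight three-qubit GHZ-basis states, the three qubits of each state being held by three different parties. For a set $T\subseteq\{1,\dots,8\}$ with $|T|=D$ and a $k$-element subset $S=\{\alpha_1,\dots,\alpha_k\}\subseteq T$ let $$\rho_S=\frac{1}{k!}\sum_{\pi\in \mathfrak S_k}|\Phi_\pi\rangle\langle\Phi_\pi|,\qquad |\Phi_\pi\rangle=|G_{\alpha_{\pi(1)}}\rangle\otimes\cdots\otimes|G_{\alpha_{\pi(k)}}\rangle,$$ be the state shared by the parties when the $k$ states of $S$ are distributed among them in an unknown order (each party then holds $k$ qubits). Given a distribution of the three parties over separated labs, the set $\{|G_\alpha\rangle\}_{\alpha\in T}$ is called locally $(D,k)$-identifiable if there is a measurement, implementable by local operations in the labs and classical communication between them (LOCC; limits of finite-round protocols are allowed), which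 for every $k$-element subset $S\subseteq T$ outputs $S$ with probability one on $\rho_S$; otherwise it is locally $(D,k)$-unidentifiable. Let $2<D\le 8$ and $1<k<D$ with $\binom{D}{k}>2^{2k}$. Then any $D$ of the eight GHZ-basis states form a locally $(D,k)$-unidentifiable set, both when the three parties are in three separated labs and when any two of the three parties join in one lab, i.e. across every one of the three bipartitions. -/

import Mathlib

open scoped Matrix

noncomputable section

namespace LSI

/-- A linear operator that a lab has applied so far to its share of the state: a matrix from the
initial local space `ℂ^ι` to the present local space `ℂ^out`.  The output space may be any
finite-dimensional space, so local ancillas and partial traces are allowed. -/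
structure LocalOp (ι : Type) where
  out : Type
  fintypeOut : Fintype out
  decOut : DecidableEq out
  mat : Matrix out ι ℂ

attribute [instance] LocalOp.fintypeOut LocalOp.decOut

/-- The identity operator: nothing has been done yet. -/
abbrev LocalOp.one (ι : Type) [Fintype ι] [DecidableEq ι] : LocalOp ι := ⟨ι, ‹_›, ‹_›, 1⟩

section LOCC

variable {L : Type} [DecidableEq L] {ι : L → Type}

/-- A finite-round LOCC protocol with final classical output in `O`, among labs `L` with initial
local spaces `ℂ^(ι ℓ)`, continued from the situation where lab `ℓ` has applied `A ℓ`.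
Either the labs announce an output, or one lab `ℓ` performs a local measurement with Kraus
operators `K j` on its present system and broadcasts the outcome `j`; the rest of the protocol
may depend on `j`. -/
inductive Protocol (O : Type) : (∀ ℓ, LocalOp (ι ℓ)) → Type 1
  | output {A : ∀ ℓ, LocalOp (ι ℓ)} (o : O) : Protocol O A
  | measure {A : ∀ ℓ, LocalOp (ι ℓ)} (ℓ : L) (r : ℕ)
      (κ : Fin r → Type) (fκ : ∀ j, Fintype (κ j)) (dκ : ∀ j, DecidableEq (κ j))
      (K : ∀ j, Matrix (κ j) (A ℓ).out ℂ)
      (complete : ∑ j, (K j)ᴴ * K j = 1)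
      (next : ∀ j, Protocol O
        (Function.update A ℓ ⟨κ j, fκ j, dκ j, K j * (A ℓ).mat⟩)) : Protocol O A

variable [Fintype L]

/-- The tensor product `⨂ ℓ, A ℓ` of the local operators. -/
def tensorOp (A : ∀ ℓ, LocalOp (ι ℓ)) : Matrix (∀ ℓ, (A ℓ).out) (∀ ℓ, ι ℓ) ℂ :=
  Matrix.of fun x y => ∏ ℓ, (A ℓ).mat (x ℓ) (y ℓ)

/-- The POVM element, on the initial joint space, of the output `o`: the sum of `Aᴴ A` over all
branches that end with output `o`, where `A` is the joint operator applied along the branch.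
On the initial state `ρ` the output is `o` with probability `tr (effect o * ρ)`. -/
def Protocol.effect {O : Type} [DecidableEq O] :
    {A : ∀ ℓ, LocalOp (ι ℓ)} → Protocol O A → O → Matrix (∀ ℓ, ι ℓ) (∀ ℓ, ι ℓ) ℂ
  | A, .output o', o => if o = o' then (tensorOp A)ᴴ * tensorOp A else 0
  | _, .measure _ _ _ _ _ _ _ next, o => ∑ j, (next j).effect o

variable (ι) [∀ ℓ, Fintype (ι ℓ)] [∀ ℓ, DecidableEq (ι ℓ)]

/-- The measurements with outcomes in `O` that finite-round LOCC protocols implement. -/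
def finiteLOCC (O : Type) [DecidableEq O] : Set (O → Matrix (∀ ℓ, ι ℓ) (∀ ℓ, ι ℓ) ℂ) :=
  Set.range fun P : Protocol O (fun ℓ => LocalOp.one (ι ℓ)) => P.effect

/-- The measurements available by LOCC.  Limits of finite-round protocols are included, so that
no protocol with infinitely many rounds is missed. -/
def LOCC (O : Type) [DecidableEq O] : Set (O → Matrix (∀ ℓ, ι ℓ) (∀ ℓ, ι ℓ) ℂ) :=
  closure (finiteLOCC ι O)

theorem finiteLOCC_subset_LOCC (O : Type) [DecidableEq O] : finiteLOCC ι O ⊆ LOCC ι O :=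
  subset_closure

end LOCC

section Identification

variable {P : Type} {β : P → Type} {L J : Type}

/-- Basis labels of the space held in lab `ℓ` when `k` systems are shared: the share of every
party `p` working in lab `ℓ` (`lab p = ℓ`) consists of `k` systems `ℂ^(β p)`. -/
abbrev LabSpace (β : P → Type) (lab : P → L) (k : ℕ) (ℓ : L) : Type :=
  ∀ p : {p : P // lab p = ℓ}, Fin k → β p

/-- The state vector `ψ (α 0) ⊗ ⋯ ⊗ ψ (α (k-1))`, the `i`-th factor living on the `i`-th system
of every party. -/
def productState (ψ : J → (∀ p, β p) → ℂ) (lab : P → L) {k : ℕ} (α : Fin k → J) :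
    (∀ ℓ, LabSpace β lab k ℓ) → ℂ :=
  fun x => ∏ i, ψ (α i) fun p => x (lab p) ⟨p, rfl⟩ i

/-- The state shared when the `k`-element subset `S` of states is distributed in an unknown order:
the uniform mixture of the product states over all `k!` orderings of `S`. -/
def subsetState [DecidableEq J] (ψ : J → (∀ p, β p) → ℂ) (lab : P → L) (k : ℕ) (S : Finset J) :
    Matrix (∀ ℓ, LabSpace β lab k ℓ) (∀ ℓ, LabSpace β lab k ℓ) ℂ :=
  ((k.factorial : ℂ))⁻¹ • ∑ e : Fin k ≃ S,
    Matrix.vecMulVec (productState ψ lab fun i => (e i : J))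
      (star (productState ψ lab fun i => (e i : J)))

/-- The set of states `{ψ j | j ∈ T}` is locally `(|T|, k)`-identifiable, the parties being
distributed over labs by `lab`: some LOCC measurement among the labs, given any `k`-element subset
`S` of `T` in unknown order, outputs `S` with probability one. -/
def IsIdentifiable [Fintype P] [DecidableEq P] [∀ p, Fintype (β p)] [∀ p, DecidableEq (β p)]
    [Fintype L] [DecidableEq L] [DecidableEq J]
    (ψ : J → (∀ p, β p) → ℂ) (T : Finset J) (k : ℕ) (lab : P → L) : Prop :=
  ∃ M ∈ LOCC (LabSpace β lab k) (Finset J),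
    ∀ S ⊆ T, S.card = k → (M S * subsetState ψ lab k S).trace = 1

end Identification

/-- Computational basis vectors of three qubits. -/
def ket (a b c : Fin 2) : (Fin 3 → Fin 2) → ℂ := Pi.single ![a, b, c] 1

/-- The eight three-qubit GHZ basis states. -/
def ghz : Fin 8 → (Fin 3 → Fin 2) → ℂ :=
  ![((√2 : ℝ) : ℂ)⁻¹ • (ket 0 0 0 + ket 1 1 1), ((√2 : ℝ) : ℂ)⁻¹ • (ket 0 0 0 - ket 1 1 1),
    ((√2 : ℝ) : ℂ)⁻¹ • (ket 0 0 1 + ket 1 1 0), ((√2 : ℝ) : ℂ)⁻¹ • (ket 0 0 1 - ket 1 1 0),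
    ((√2 : ℝ) : ℂ)⁻¹ • (ket 0 1 0 + ket 1 0 1), ((√2 : ℝ) : ℂ)⁻¹ • (ket 0 1 0 - ket 1 0 1),
    ((√2 : ℝ) : ℂ)⁻¹ • (ket 1 0 0 + ket 0 1 1), ((√2 : ℝ) : ℂ)⁻¹ • (ket 1 0 0 - ket 0 1 1)]

end LSI

end

namespace LSI

/-! Along each branch of a finite protocol the applied operator is a tensor product over the labs,
so its rows are product covectors. Let party `p` be alone in its lab. In a product of `k` GHZ basis
states the qubits of `p` are maximally mixed, with reduced state `2⁻ᵏ • 1`, so such a covector has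
squared overlap at most `2⁻ᵏ` times its squared norm (`norm_sq_productState_overlap_le`). Summing
over rows and branches gives `tr (E_S ρ_S) ≤ 2⁻ᵏ tr E_S` (`effect_overlap_le`,
`trace_mul_subsetState_le`).

The effects are positive and sum to the identity on a space of dimension `2 ^ (3 * k)`, so the
success probabilities, summed over all `S`, are at most `2 ^ (2 * k)`. This bound is a closed
condition, hence holds for limits of protocols; perfect identification would make the sum `D.choose
k`. -/

/-- A product covector `f ⊗ g` has overlap at most `c ‖f‖² ‖g‖²` with a bipartite vector whose
reduced state on the first factor is `c • 1`. -/
theorem norm_sq_overlap_le {X Y : Type*} [Fintype X] [Fintype Y] [DecidableEq X]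
    (f : X → ℂ) (g : Y → ℂ) (Φ : X → Y → ℂ) (c : ℝ)
    (hΦ : ∀ u u', ∑ v, Φ u v * star (Φ u' v) = if u = u' then (c : ℂ) else 0) :
    ‖∑ u, ∑ v, f u * g v * Φ u v‖ ^ 2 ≤ c * ((∑ u, ‖f u‖ ^ 2) * ∑ v, ‖g v‖ ^ 2) := by
  -- Contracting with `f` first leaves a vector of squared norm `c ‖f‖²`, because the reduced state
  -- is `c • 1`; Cauchy–Schwarz against `g` then finishes.
  have hh : ∑ v, ‖∑ u, f u * Φ u v‖ ^ 2 = c * ∑ u, ‖f u‖ ^ 2 := by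
    have : ((∑ v, ‖∑ u, f u * Φ u v‖ ^ 2 : ℝ) : ℂ) = ((c * ∑ u, ‖f u‖ ^ 2 : ℝ) : ℂ) := by
      push_cast
      calc ∑ v, (‖∑ u, f u * Φ u v‖ : ℂ) ^ 2
          = ∑ v, ∑ u, ∑ u', f u * star (f u') * (Φ u v * star (Φ u' v)) := by
            refine Finset.sum_congr rfl fun v _ => ?_
            rw [← Complex.mul_conj', map_sum, Finset.sum_mul_sum]
            refine Finset.sum_congr rfl fun u _ => Finset.sum_congr rfl fun u' _ => ?_
            simp only [map_mul, Complex.star_def]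
            ring
        _ = ∑ u, ∑ u', f u * star (f u') * ∑ v, Φ u v * star (Φ u' v) := by
            rw [Finset.sum_comm]
            refine Finset.sum_congr rfl fun u _ => ?_
            rw [Finset.sum_comm]
            simp only [Finset.mul_sum]
        _ = c * ∑ u, (‖f u‖ : ℂ) ^ 2 := by
            simp only [hΦ, mul_ite, mul_zero, Finset.sum_ite_eq, Finset.mem_univ, if_true,
              Finset.mul_sum]
            refine Finset.sum_congr rfl fun u _ => ?_
            rw [← Complex.mul_conj', Complex.star_def]
            ring
    exact_mod_cast this
  have hsum : ∑ u, ∑ v, f u * g v * Φ u v = ∑ v, g v * ∑ u, f u * Φ u v := by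
    rw [Finset.sum_comm]
    refine Finset.sum_congr rfl fun v _ => ?_
    rw [Finset.mul_sum]
    exact Finset.sum_congr rfl fun u _ => by ring
  calc ‖∑ u, ∑ v, f u * g v * Φ u v‖ ^ 2
      ≤ (∑ v, ‖g v‖ * ‖∑ u, f u * Φ u v‖) ^ 2 := by
        rw [hsum]
        gcongr
        exact (norm_sum_le _ _).trans_eq (by simp only [norm_mul])
    _ ≤ (∑ v, ‖g v‖ ^ 2) * ∑ v, ‖∑ u, f u * Φ u v‖ ^ 2 := Finset.sum_mul_sq_le_sq_mul_sq _ _ _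
    _ = c * ((∑ u, ‖f u‖ ^ 2) * ∑ v, ‖g v‖ ^ 2) := by rw [hh]; ring

/-! ### Marginals of the GHZ basis states -/

/-- A computational basis vector with integer amplitudes. -/
def ketInt (a b c : Fin 2) (w : Fin 3 → Fin 2) : ℤ := if w = ![a, b, c] then 1 else 0

/-- The amplitudes of the GHZ basis states, multiplied by `√2`. -/
def ghzInt : Fin 8 → (Fin 3 → Fin 2) → ℤ :=
  ![ketInt 0 0 0 + ketInt 1 1 1, ketInt 0 0 0 - ketInt 1 1 1,
    ketInt 0 0 1 + ketInt 1 1 0, ketInt 0 0 1 - ketInt 1 1 0,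
    ketInt 0 1 0 + ketInt 1 0 1, ketInt 0 1 0 - ketInt 1 0 1,
    ketInt 1 0 0 + ketInt 0 1 1, ketInt 1 0 0 - ketInt 0 1 1]

theorem ghz_eq (j : Fin 8) (w : Fin 3 → Fin 2) :
    ghz j w = ((√2 : ℝ) : ℂ)⁻¹ * (ghzInt j w : ℂ) := by
  fin_cases j <;> simp [ghz, ghzInt, ket, ketInt, Pi.single_apply, mul_add, mul_sub]

/-- Clearing the factor `1/√2` turns the marginals into a finite integer computation, which the
kernel decides. -/
theorem ghzInt_marginal : ∀ (j : Fin 8) (p : Fin 3) (u u' : Fin 2),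
    ∑ v : Fin 2 → Fin 2, ghzInt j (p.insertNth (α := fun _ => Fin 2) u v) *
      ghzInt j (p.insertNth (α := fun _ => Fin 2) u' v) = if u = u' then 1 else 0 := by
  decide +kernel

/-- Every qubit of a GHZ basis state is maximally mixed. -/
theorem ghz_marginal (j : Fin 8) (p : Fin 3) (u u' : Fin 2) :
    ∑ v : Fin 2 → Fin 2, ghz j (p.insertNth (α := fun _ => Fin 2) u v) *
      star (ghz j (p.insertNth (α := fun _ => Fin 2) u' v)) = if u = u' then 2⁻¹ else 0 := by
  have h2 : ((√2 : ℝ) : ℂ)⁻¹ * ((√2 : ℝ) : ℂ)⁻¹ = 2⁻¹ := by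
    rw [← mul_inv, ← Complex.ofReal_mul, Real.mul_self_sqrt (by norm_num)]
    norm_num
  have h := congrArg (fun z : ℤ => (2⁻¹ : ℂ) * z) (ghzInt_marginal j p u u')
  push_cast at h
  rw [Finset.mul_sum, mul_ite, mul_one, mul_zero] at h
  rw [← h]
  refine Finset.sum_congr rfl fun v _ => ?_
  rw [ghz_eq, ghz_eq, ← h2]
  simp only [Complex.star_def, map_mul, map_inv₀, Complex.conj_ofReal, map_intCast]
  ring

/-- The joint basis labels, split into the labels of party `p` and those of the two others. -/
def splitParty {L : Type} (lab : Fin 3 → L) (k : ℕ) (p : Fin 3) :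
    (Fin k → Fin 2) × (Fin k → Fin 2 → Fin 2) ≃
      ∀ ℓ, LabSpace (fun _ : Fin 3 => Fin 2) lab k ℓ where
  toFun uv := fun _ q i => p.insertNth (α := fun _ => Fin 2) (uv.1 i) (uv.2 i) q.1
  invFun y := (fun i => y (lab p) ⟨p, rfl⟩ i,
    fun i r => y (lab (p.succAbove r)) ⟨p.succAbove r, rfl⟩ i)
  left_inv uv := by simp
  right_inv y := by
    funext ℓ ⟨q, hq⟩ i
    subst hq
    rcases Fin.eq_self_or_eq_succAbove p q with rfl | ⟨r, rfl⟩ <;> simp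

/-! ### Overlap bound along a branch -/

section Branch

variable {L : Type} [Fintype L] [DecidableEq L]

/-- A product covector over the labs has overlap at most `2⁻ᵏ` with a product of `k` GHZ basis
states, if some lab hosts only one party. -/
theorem norm_sq_productState_overlap_le {lab : Fin 3 → L} {p : Fin 3}
    (hp : ∀ q, lab q = lab p → q = p) {k : ℕ} (α : Fin k → Fin 8)
    (a : ∀ ℓ, LabSpace (fun _ : Fin 3 => Fin 2) lab k ℓ → ℂ) :
    ‖∑ y, (∏ ℓ, a ℓ (y ℓ)) * productState ghz lab α y‖ ^ 2 ≤
      (2⁻¹ : ℝ) ^ k * ∑ y : ∀ ℓ, LabSpace (fun _ : Fin 3 => Fin 2) lab k ℓ,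
        ‖∏ ℓ, a ℓ (y ℓ)‖ ^ 2 := by
  set E := splitParty lab k p
  -- The zeros here and in `g` are dummies: the lab of `p` sees only `u`, since `p` is alone there,
  -- and the other labs see only `v`.
  set f : (Fin k → Fin 2) → ℂ := fun u => a (lab p) (E (u, 0) (lab p))
  set g : (Fin k → Fin 2 → Fin 2) → ℂ :=
    fun v => ∏ ℓ ∈ Finset.univ.erase (lab p), a ℓ (E (0, v) ℓ)
  have hfg : ∀ u v, ∏ ℓ, a ℓ (E (u, v) ℓ) = f u * g v := by
    intro u v
    rw [← Finset.mul_prod_erase _ _ (Finset.mem_univ (lab p))]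
    congr 1
    · congr 1
      funext ⟨q, hq⟩ i
      obtain rfl := hp q hq
      simp [E, splitParty]
    · refine Finset.prod_congr rfl fun ℓ hℓ => ?_
      congr 1
      funext ⟨q, hq⟩ i
      rcases Fin.eq_self_or_eq_succAbove p q with rfl | ⟨r, rfl⟩
      · exact absurd hq.symm (Finset.ne_of_mem_erase hℓ)
      · simp [E, splitParty]
  have hΦ : ∀ u u', ∑ v, productState ghz lab α (E (u, v)) *
      star (productState ghz lab α (E (u', v))) =
        if u = u' then (((2⁻¹ : ℝ) ^ k : ℝ) : ℂ) else 0 := by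
    intro u u'
    have : ∀ v, productState ghz lab α (E (u, v)) * star (productState ghz lab α (E (u', v))) =
        ∏ i, ghz (α i) (p.insertNth (α := fun _ => Fin 2) (u i) (v i)) *
          star (ghz (α i) (p.insertNth (α := fun _ => Fin 2) (u' i) (v i))) := by
      intro v
      simp only [productState, star_prod, Finset.prod_mul_distrib, E, splitParty, Equiv.coe_fn_mk]
    simp only [this]
    -- The partial trace factors over the `k` copies.
    rw [← Fintype.prod_sum fun i w => ghz (α i) (p.insertNth (α := fun _ => Fin 2) (u i) w) *
          star (ghz (α i) (p.insertNth (α := fun _ => Fin 2) (u' i) w))]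
    simp only [ghz_marginal]
    split_ifs with h
    · subst h
      simp
    · obtain ⟨i, hi⟩ := Function.ne_iff.mp h
      exact Finset.prod_eq_zero (Finset.mem_univ i) (if_neg hi)
  have key := norm_sq_overlap_le f g (fun u v => productState ghz lab α (E (u, v))) _ hΦ
  rw [← E.sum_comp, ← E.sum_comp, Fintype.sum_prod_type, Fintype.sum_prod_type]
  simp only [hfg]
  refine key.trans_eq ?_
  simp only [Finset.sum_mul_sum, norm_mul, mul_pow]

theorem trace_conjTranspose_mul_self_re {m n : Type*} [Fintype m] [Fintype n]
    (B : Matrix m n ℂ) : (Bᴴ * B).trace.re = ∑ x, ∑ y, ‖B x y‖ ^ 2 := by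
  rw [Finset.sum_comm]
  simp only [Matrix.trace, Matrix.diag, Matrix.mul_apply, Matrix.conjTranspose_apply,
    Complex.re_sum]
  refine Finset.sum_congr rfl fun y _ => Finset.sum_congr rfl fun x _ => ?_
  rw [Complex.star_def, Complex.conj_mul', ← Complex.ofReal_pow, Complex.ofReal_re]

theorem trace_gram_mul_vecMulVec_re {m n : Type*} [Fintype m] [Fintype n]
    (B : Matrix m n ℂ) (Φ : n → ℂ) :
    (Bᴴ * B * Matrix.vecMulVec Φ (star Φ)).trace.re = ∑ x, ‖∑ y, B x y * Φ y‖ ^ 2 := by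
  rw [Matrix.mul_vecMulVec, Matrix.trace_vecMulVec, ← Matrix.mulVec_mulVec, dotProduct_comm,
    Matrix.dotProduct_mulVec, ← Matrix.star_mulVec]
  simp only [dotProduct, Complex.re_sum]
  refine Finset.sum_congr rfl fun x _ => ?_
  rw [Pi.star_apply, Complex.star_def, Complex.conj_mul', ← Complex.ofReal_pow, Complex.ofReal_re]
  rfl

theorem effect_overlap_le {lab : Fin 3 → L} {p : Fin 3} (hp : ∀ q, lab q = lab p → q = p)
    {k : ℕ} (α : Fin k → Fin 8) {O : Type} [DecidableEq O]
    {A : ∀ ℓ, LocalOp (LabSpace (fun _ : Fin 3 => Fin 2) lab k ℓ)} (P : Protocol O A) (o : O) :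
    (P.effect o * Matrix.vecMulVec (productState ghz lab α)
      (star (productState ghz lab α))).trace.re ≤ (2⁻¹ : ℝ) ^ k * (P.effect o).trace.re := by
  induction P with
  | @output A o' =>
    rw [Protocol.effect]
    split_ifs
    · rw [trace_gram_mul_vecMulVec_re, trace_conjTranspose_mul_self_re, Finset.mul_sum]
      exact Finset.sum_le_sum fun x _ =>
        norm_sq_productState_overlap_le hp α fun ℓ y => (A ℓ).mat (x ℓ) y
    · simp
  | measure ℓ r κ fκ dκ K complete next ih =>
    rw [Protocol.effect, Finset.sum_mul, Matrix.trace_sum, Matrix.trace_sum, Complex.re_sum,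
      Complex.re_sum, Finset.mul_sum]
    exact Finset.sum_le_sum fun j _ => ih j

end Branch

/-! ### Effects sum to the identity -/

section Completeness

variable {L : Type} [Fintype L] [DecidableEq L] {ι : L → Type}

theorem tensorOp_gram_apply (A : ∀ ℓ, LocalOp (ι ℓ)) (x y : ∀ ℓ, ι ℓ) :
    ((tensorOp A)ᴴ * tensorOp A) x y = ∏ ℓ, ((A ℓ).matᴴ * (A ℓ).mat) (x ℓ) (y ℓ) := by
  simp only [Matrix.mul_apply, Matrix.conjTranspose_apply, tensorOp, Matrix.of_apply, star_prod,
    ← Finset.prod_mul_distrib]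
  exact (Fintype.prod_sum fun ℓ z => star ((A ℓ).mat z (x ℓ)) * (A ℓ).mat z (y ℓ)).symm

/-- The effects of a protocol sum up to the effect of what has been applied before. -/
theorem sum_effect {O : Type} [DecidableEq O] [Fintype O] {A : ∀ ℓ, LocalOp (ι ℓ)}
    (P : Protocol O A) : ∑ o, P.effect o = (tensorOp A)ᴴ * tensorOp A := by
  induction P with
  | output o' => simp [Protocol.effect]
  | @measure A ℓ r κ fκ dκ K complete next ih =>
    simp only [Protocol.effect]
    rw [Finset.sum_comm]
    simp only [ih]
    ext x y
    rw [Matrix.sum_apply, tensorOp_gram_apply, ← Finset.mul_prod_erase _ _ (Finset.mem_univ ℓ)]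
    -- A measurement in lab `ℓ` changes only the `ℓ`-th Gram factor, where `complete` then removes
    -- the Kraus operators.
    have hj : ∀ j, ((tensorOp (Function.update A ℓ ⟨κ j, fκ j, dκ j, K j * (A ℓ).mat⟩))ᴴ *
        tensorOp (Function.update A ℓ ⟨κ j, fκ j, dκ j, K j * (A ℓ).mat⟩)) x y =
        ((A ℓ).matᴴ * ((K j)ᴴ * K j) * (A ℓ).mat) (x ℓ) (y ℓ) *
          ∏ ℓ' ∈ Finset.univ.erase ℓ, ((A ℓ').matᴴ * (A ℓ').mat) (x ℓ') (y ℓ') := by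
      intro j
      rw [tensorOp_gram_apply, ← Finset.mul_prod_erase _ _ (Finset.mem_univ ℓ)]
      congr 1
      · rw [Function.update_self, Matrix.conjTranspose_mul]
        simp only [Matrix.mul_assoc]
      · refine Finset.prod_congr rfl fun ℓ' hℓ' => ?_
        rw [Function.update_of_ne (Finset.ne_of_mem_erase hℓ')]
    simp only [hj]
    rw [← Finset.sum_mul, ← Matrix.sum_apply, ← Matrix.sum_mul, ← Matrix.mul_sum, complete,
      Matrix.mul_one]

theorem sum_effect_one [∀ ℓ, Fintype (ι ℓ)] [∀ ℓ, DecidableEq (ι ℓ)]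
    {O : Type} [DecidableEq O] [Fintype O]
    (P : Protocol O (fun ℓ => LocalOp.one (ι ℓ))) : ∑ o, P.effect o = 1 := by
  rw [sum_effect]
  ext x y
  rw [tensorOp_gram_apply]
  simp only [Matrix.conjTranspose_one, Matrix.one_mul, Matrix.one_apply]
  split_ifs with h
  · subst h
    simp
  · obtain ⟨ℓ, hℓ⟩ := Function.ne_iff.mp h
    exact Finset.prod_eq_zero (Finset.mem_univ ℓ) (if_neg hℓ)

end Completeness

/-! ### Counting bound -/

section Main

variable {L : Type} [Fintype L] [DecidableEq L]

theorem trace_effect_re_nonneg {ι : L → Type} [∀ ℓ, Fintype (ι ℓ)] {O : Type} [DecidableEq O]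
    {A : ∀ ℓ, LocalOp (ι ℓ)} (P : Protocol O A) (o : O) : 0 ≤ (P.effect o).trace.re := by
  induction P with
  | output o' =>
    rw [Protocol.effect]
    split_ifs
    · rw [trace_conjTranspose_mul_self_re]
      positivity
    · simp
  | measure ℓ r κ fκ dκ K complete next ih =>
    rw [Protocol.effect, Matrix.trace_sum, Complex.re_sum]
    exact Finset.sum_nonneg fun j _ => ih j

/-- The state is an average over orderings, so a bound valid for every ordering survives. -/
theorem trace_mul_subsetState_le {lab : Fin 3 → L} {k : ℕ} {S : Finset (Fin 8)}
    (hS : S.card = k) {c : ℝ}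
    (B : Matrix (∀ ℓ, LabSpace (fun _ : Fin 3 => Fin 2) lab k ℓ)
      (∀ ℓ, LabSpace (fun _ : Fin 3 => Fin 2) lab k ℓ) ℂ)
    (hB : ∀ α : Fin k → Fin 8, (B * Matrix.vecMulVec (productState ghz lab α)
      (star (productState ghz lab α))).trace.re ≤ c) :
    (B * subsetState ghz lab k S).trace.re ≤ c := by
  have hcard : Fintype.card (Fin k ≃ S) = k.factorial := by
    rw [Fintype.card_equiv (Fintype.equivOfCardEq (by simp [hS])), Fintype.card_fin]
  have hk : (0 : ℝ) < k.factorial := by exact_mod_cast k.factorial_pos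
  rw [subsetState, Matrix.mul_smul, Matrix.trace_smul, Finset.mul_sum, Matrix.trace_sum,
    smul_eq_mul, ← Complex.ofReal_natCast, ← Complex.ofReal_inv, Complex.re_ofReal_mul,
    Complex.re_sum, inv_mul_le_iff₀ hk, ← hcard]
  refine (Finset.sum_le_card_nsmul _ _ c fun e _ => hB _).trans_eq ?_
  rw [nsmul_eq_mul, Finset.card_univ]

/-- If some lab hosts only one party, at most `4ᵏ` subsets can be told apart. -/
theorem choose_le_of_isIdentifiable {lab : Fin 3 → L} {p : Fin 3}
    (hp : ∀ q, lab q = lab p → q = p) {k : ℕ} {T : Finset (Fin 8)}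
    (hT : IsIdentifiable ghz T k lab) : T.card.choose k ≤ 2 ^ (2 * k) := by
  obtain ⟨M, hM, hMS⟩ := hT
  have hbound : ∑ S ∈ T.powersetCard k, (M S * subsetState ghz lab k S).trace.re ≤
      (2 : ℝ) ^ (2 * k) := by
    -- Closedness reduces the bound to finite-round protocols.
    have hclosed : IsClosed {M : Finset (Fin 8) →
        Matrix (∀ ℓ, LabSpace (fun _ : Fin 3 => Fin 2) lab k ℓ)
          (∀ ℓ, LabSpace (fun _ : Fin 3 => Fin 2) lab k ℓ) ℂ |
        ∑ S ∈ T.powersetCard k, (M S * subsetState ghz lab k S).trace.re ≤ (2 : ℝ) ^ (2 * k)} := by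
      refine isClosed_le (continuous_finsetSum _ fun S _ => Complex.continuous_re.comp ?_)
        continuous_const
      exact ((continuous_apply S).matrix_mul continuous_const).matrix_trace
    refine closure_minimal ?_ hclosed hM
    rintro _ ⟨P, rfl⟩
    have hdim : Fintype.card (∀ ℓ, LabSpace (fun _ : Fin 3 => Fin 2) lab k ℓ) =
        2 ^ k * 2 ^ (2 * k) := by
      rw [← Fintype.card_congr (splitParty lab k p)]
      simp [pow_mul]
    calc ∑ S ∈ T.powersetCard k, (P.effect S * subsetState ghz lab k S).trace.re
        ≤ ∑ S ∈ T.powersetCard k, (2⁻¹ : ℝ) ^ k * (P.effect S).trace.re :=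
          Finset.sum_le_sum fun S hS => trace_mul_subsetState_le (Finset.mem_powersetCard.mp hS).2
            _ fun α => effect_overlap_le hp α P S
      -- Outputs other than `k`-subsets of `T` are added so that completeness applies.
      _ ≤ ∑ S, (2⁻¹ : ℝ) ^ k * (P.effect S).trace.re :=
          Finset.sum_le_univ_sum_of_nonneg fun S =>
            mul_nonneg (by positivity) (trace_effect_re_nonneg P S)
      _ = (2⁻¹ : ℝ) ^ k * (2 ^ k * 2 ^ (2 * k)) := by
          rw [← Finset.mul_sum, ← Complex.re_sum, ← Matrix.trace_sum, sum_effect_one,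
            Matrix.trace_one, hdim]
          norm_cast
      _ = 2 ^ (2 * k) := by
          rw [← mul_assoc, ← mul_pow]
          norm_num
  have hone : ∑ S ∈ T.powersetCard k, (M S * subsetState ghz lab k S).trace.re =
      (T.card.choose k : ℝ) := by
    rw [← Finset.card_powersetCard, ← nsmul_one, ← Finset.sum_const]
    refine Finset.sum_congr rfl fun S hS => ?_
    obtain ⟨h₁, h₂⟩ := Finset.mem_powersetCard.mp hS
    rw [hMS S h₁ h₂, Complex.one_re]
  rw [hone] at hbound
  exact_mod_cast hbound

end Main

/-- Of three parties in two nonempty labs, one is alone. -/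
theorem exists_party_alone : ∀ lab : Fin 3 → Fin 2, Function.Surjective lab →
    ∃ p, ∀ q, lab q = lab p → q = p := by
  decide +kernel

end LSI

theorem mainTheorem4 (D k : ℕ) (hD : 2 < D) (hD8 : D ≤ 8) (hk : 1 < k) (hkD : k < D)
    (h : 2 ^ (2 * k) < D.choose k) (T : Finset (Fin 8)) (hT : T.card = D) :
    (∀ lab : Fin 3 → Fin 2, Function.Surjective lab → ¬ LSI.IsIdentifiable LSI.ghz T k lab) ∧
      ¬ LSI.IsIdentifiable LSI.ghz T k (id : Fin 3 → Fin 3) := by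
  subst hT
  refine ⟨fun lab hlab hid => ?_, fun hid => ?_⟩
  · obtain ⟨p, hp⟩ := LSI.exists_party_alone lab hlab
    exact absurd (LSI.choose_le_of_isIdentifiable hp hid) (not_le.mpr h)
  · exact absurd (LSI.choose_le_of_isIdentifiable (p := 0) (fun q hq => hq) hid) (not_le.mpr h)
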